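/- Let $H_{3,d}$ be the space of real forms of degree $d$ in three variables, $P_{3,6}\subset H_{3,6}$ the cone of forms that are nonnegative on $\mathbb R^3$, $\Sigma_{3,6}=\{\sum_i f_i^2 : f_i\in H_{3,3}\}$ (finite sums) the cone of sums of squares, $\Sigma_{3,6}^*$ the cone of linear functionals $l:H_{3,6}\to\mathbb R$ with $l(f)\ge 0$ for all $f\in\Sigma_{3,6}$, and let $\mathcal V(f)$ denote the set of real projective zeros of a form $f$. Let $v_1,\dots,v_9\in\mathbb R^3\setminus\{0\}$ represent nine distinct points of the real projective plane such that no four of these points lie on a line, no seven lie on a quadric (conic), and the set $A$ of these nine points equals $\mathcal V(q_1)\cap\mathcal V(q_2)$ for some coprime $q_1,q_2\in H_{3,3}$. Let $p\in P_{3,6}\setminus\Sigma_{3,6}$ be such that $\mathcal V(p)$ consists exactly of the seven points represented by $v_1,\dots,v_7$. 1. There is a cubic $h\in H_{3,3}$ with $\mathcal V(p)\subseteq\mathcal V(h)$, $h(v_8)\neq 0$ and $h(v_9)\neq 0$. 2. Let $h\in H_{3,3}$ be any cubic with $\mathcal V(p)\subseteq\mathcal V(h)$. If $$h(v_9)^2\,p(v_8)\;\neq\;h(v_8)^2\,p(v_9),$$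 then there is $a\in\mathbb R^9$ such that the functional $l_a:H_{3,6}\to\mathbb R$, $l_a(f)=\sum_{j=1}^9 a_j f(v_j)$, lies in $\Sigma_{3,6}^*$, satisfies $l_a(p)<0$ (so $l_a$ certifies that $p$ is not a sum of squares), and spans an extreme ray of $\Sigma_{3,6}^*$. -/

import Mathlib

open scoped LinearAlgebra.Projectivization

namespace SosRays

/-- `H_{n,d}`: the real vector space of real forms of degree `d` in `n` variables. -/
abbrev Form (n d : ℕ) : Type := MvPolynomial.homogeneousSubmodule (Fin n) ℝ d

/-- The value of a form at a point of `ℝⁿ`. -/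
noncomputable def value {n d : ℕ} (x : Fin n → ℝ) (f : Form n d) : ℝ :=
  MvPolynomial.eval x (f : MvPolynomial (Fin n) ℝ)

/-- `P_{n,2d}`: the forms of degree `2d` that are nonnegative on `ℝⁿ`. -/
def psdForms (n d : ℕ) : Set (Form n (2 * d)) :=
  {f | ∀ x : Fin n → ℝ, 0 ≤ value x f}

/-- `Σ_{n,2d}`: the finite sums of squares of forms of degree `d`. -/
def sosForms (n d : ℕ) : Set (Form n (2 * d)) :=
  {f | ∃ (r : ℕ) (g : Fin r → Form n d),
    (f : MvPolynomial (Fin n) ℝ) = ∑ i, (g i : MvPolynomial (Fin n) ℝ) ^ 2}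

/-- The dual cone `Σ_{n,2d}^*`: the linear functionals on `H_{n,2d}` that are nonnegative on all
sums of squares. -/
noncomputable def sosDual (n d : ℕ) : PointedCone ℝ (Module.Dual ℝ (Form n (2 * d))) :=
  PointedCone.dual (Module.Dual.eval ℝ (Form n (2 * d))) (sosForms n d)

/-- `l` spans an extreme ray of the cone `C`: it is a nonzero element of `C`, and in every
decomposition `l = l₁ + l₂` inside `C` the summands are nonnegative multiples of `l`
(it suffices to say this for `l₁`, by symmetry). -/
def SpansExtremeRay {E : Type*} [AddCommGroup E] [Module ℝ E] (C : PointedCone ℝ E) (l : E) :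
    Prop :=
  l ∈ C ∧ l ≠ 0 ∧ ∀ l₁ ∈ C, ∀ l₂ ∈ C, l₁ + l₂ = l → ∃ c : ℝ, 0 ≤ c ∧ l₁ = c • l

/-- The real projective variety of a form. A form vanishes at one representative of a projective
point if and only if it vanishes at all of them, see `mk_mem_projVariety`. -/
def projVariety {n d : ℕ} (f : Form n d) : Set (ℙ ℝ (Fin n → ℝ)) :=
  {x | value x.rep f = 0}

theorem value_smul {n d : ℕ} (c : ℝ) (x : Fin n → ℝ) (f : Form n d) :
    value (c • x) f = c ^ d * value x f := by
  have hf : (f : MvPolynomial (Fin n) ℝ).IsHomogeneous d :=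
    (MvPolynomial.mem_homogeneousSubmodule d _).1 f.2
  unfold value
  rw [MvPolynomial.eval_eq, MvPolynomial.eval_eq, Finset.mul_sum]
  refine Finset.sum_congr rfl fun m hm => ?_
  have hdeg : ∑ i ∈ m.support, m i = d := by
    have h := hf (MvPolynomial.mem_support_iff.1 hm)
    simpa [Finsupp.weight_apply, Finsupp.sum] using h
  simp only [Pi.smul_apply, smul_eq_mul, mul_pow, Finset.prod_mul_distrib]
  rw [Finset.prod_pow_eq_pow_sum, hdeg]
  ring

theorem mk_mem_projVariety {n d : ℕ} (f : Form n d) (x : Fin n → ℝ) (hx : x ≠ 0) :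
    Projectivization.mk ℝ x hx ∈ projVariety f ↔ value x f = 0 := by
  obtain ⟨a, ha⟩ := Projectivization.exists_smul_eq_mk_rep ℝ x hx
  change value (Projectivization.mk ℝ x hx).rep f = 0 ↔ _
  rw [← ha, Units.smul_def, value_smul]
  simp

/-- The genericity condition for a family of points of the projective plane, given by affine
representatives: no four of them lie on a line and no seven on a quadric (a conic, possibly
degenerate). -/
def IsGeneric {k : ℕ} (v : Fin k → Fin 3 → ℝ) : Prop :=
  (∀ s : Finset (Fin k), s.card = 4 → ¬ ∃ f : Form 3 1, f ≠ 0 ∧ ∀ i ∈ s, value (v i) f = 0) ∧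
  (∀ s : Finset (Fin k), s.card = 7 → ¬ ∃ f : Form 3 2, f ≠ 0 ∧ ∀ i ∈ s, value (v i) f = 0)

/-- The set `S` of points of the real projective plane is the intersection of two coprime real
ternary cubics. -/
def IsIntersectionOfCubics (S : Set (ℙ ℝ (Fin 3 → ℝ))) : Prop :=
  ∃ q₁ q₂ : Form 3 3,
    IsRelPrime (q₁ : MvPolynomial (Fin 3) ℝ) (q₂ : MvPolynomial (Fin 3) ℝ) ∧
    projVariety q₁ ∩ projVariety q₂ = S

/-- The linear functional `l_a : f ↦ ∑ j, a j * f (v j)` on `H_{n,d}`. -/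
noncomputable def pointFunctional {n d k : ℕ} (v : Fin k → Fin n → ℝ) (a : Fin k → ℝ) :
    Module.Dual ℝ (Form n d) where
  toFun f := ∑ j, a j * value (v j) f
  map_add' f g := by simp [value, mul_add, Finset.sum_add_distrib]
  map_smul' c f := by
    simp only [value, Submodule.coe_smul, MvPolynomial.smul_eval, RingHom.id_apply, smul_eq_mul,
      Finset.mul_sum]
    exact Finset.sum_congr rfl fun j _ => by ring

end SosRays

open SosRays

namespace SosRays

/-! By Cayley–Bacharach, the values of cubics at the nine points fill a hyperplane `∑ i, u i * x i =
0` with every `u i` nonzero (`exists_isCubicRelation`). On squares, `l_a` is therefore the diagonal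
form `∑ i, a i * x i ^ 2` restricted to this hyperplane. If one `a i` is negative, the others are
positive and `∑ i, u i ^ 2 / a i = 0`, the restriction is nonnegative (`sum_mul_sq_nonneg`), with
radical spanned by the vector `u i / a i`. A summand of such an `l_a` in the dual cone kills every
cubic multiple of `q₁`, `q₂` and of a cubic `q₀` with values `u i / a i`. By Max Noether
(`ker_evalAt_sextic_eq`) it is a point functional, and `q₀` fixes its coefficients up to scale; this
is extremality (`IsCubicRelation.spansExtremeRay`). Only the two points off the zero set of `p`
contribute to `l_a(p)`. The relation for `h` turns the hypothesis into an inequality between the two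
numbers `u i ^ 2 * p (v i)`; putting the negative coefficient at the larger one allows `l_a(p) < 0`
(`exists_weights`). -/

theorem finrank_form (d : ℕ) : Module.finrank ℝ (Form 3 d) = (d + 2).choose d := by
  have hs : {m : Fin 3 →₀ ℕ | m.degree = d} =
      ↑((Finset.univ : Finset (Fin 3)).finsuppAntidiag d) := by
    ext m
    simp [Finset.mem_finsuppAntidiag, Finsupp.degree_eq_sum]
  unfold Form
  rw [MvPolynomial.homogeneousSubmodule_eq_finsupp_supported, hs,
    (AddMonoidAlgebra.supportedEquivFinsupp (R := ℝ) (S := ℝ) _).finrank_eq,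
    Module.finrank_finsupp_self]
  rw [← Nat.card_eq_fintype_card, SetLike.coe_sort_coe, Nat.card_eq_fintype_card, Fintype.card_coe,
    Finset.card_finsuppAntidiag_nat_eq_choose, add_comm]
  simp

instance finite_form (n d : ℕ) : Module.Finite ℝ (Form n d) :=
  Module.Finite.iff_fg.2 (MvPolynomial.homogeneousSubmodule_fg (σ := Fin n) (R := ℝ) d)

/-! ### Evaluation and multiplication of forms -/

section Values

variable {n d e : ℕ} (x : Fin n → ℝ)

@[simp] theorem value_zero : value x (0 : Form n d) = 0 := by simp [value]

@[simp] theorem value_add (f g : Form n d) : value x (f + g) = value x f + value x g := by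
  simp [value]

@[simp] theorem value_smul_form (c : ℝ) (f : Form n d) : value x (c • f) = c * value x f := by
  simp [value, MvPolynomial.smul_eval]

/-- The values of a form at a family of points, as a linear map. -/
noncomputable def evalAt {k : ℕ} (d : ℕ) (v : Fin k → Fin n → ℝ) : Form n d →ₗ[ℝ] (Fin k → ℝ) where
  toFun f j := value (v j) f
  map_add' f g := by ext; simp
  map_smul' c f := by ext; simp

@[simp] theorem evalAt_apply {k : ℕ} (v : Fin k → Fin n → ℝ) (f : Form n d) (j : Fin k) :
    evalAt d v f j = value (v j) f := rfl

/-- The product of forms, as a bilinear map. -/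
noncomputable def mulForm {d e m : ℕ} (h : d + e = m) :
    Form n d →ₗ[ℝ] Form n e →ₗ[ℝ] Form n m :=
  LinearMap.mk₂ ℝ (fun f g => ⟨f * g, h ▸ MvPolynomial.IsHomogeneous.mul f.2 g.2⟩)
    (fun f f' g => by ext1; simp [add_mul])
    (fun c f g => by ext1; simp)
    (fun f g g' => by ext1; simp [mul_add])
    (fun c f g => by ext1; simp)

@[simp] theorem coe_mulForm {m : ℕ} (h : d + e = m) (f : Form n d) (g : Form n e) :
    (mulForm h f g : MvPolynomial (Fin n) ℝ) = f * g := rfl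

@[simp] theorem value_mulForm {m : ℕ} (h : d + e = m) (f : Form n d) (g : Form n e) :
    value x (mulForm h f g) = value x f * value x g := by
  simp [value]

end Values

/-! ### Lines and general position -/

/-- The linear form vanishing on the span of two vectors of `ℝ³`. -/
noncomputable def lineThrough (x y : Fin 3 → ℝ) : Form 3 1 :=
  ⟨∑ i, MvPolynomial.C (crossProduct x y i) * MvPolynomial.X i,
    MvPolynomial.IsHomogeneous.sum _ _ _ fun i _ => MvPolynomial.isHomogeneous_C_mul_X _ i⟩

theorem value_lineThrough (x y z : Fin 3 → ℝ) :
    value z (lineThrough x y) = (x 1 * y 2 - x 2 * y 1) * z 0 + (x 2 * y 0 - x 0 * y 2) * z 1 +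
      (x 0 * y 1 - x 1 * y 0) * z 2 := by
  simp [value, lineThrough, cross_apply, Fin.sum_univ_three]

@[simp] theorem value_lineThrough_left (x y : Fin 3 → ℝ) : value x (lineThrough x y) = 0 := by
  rw [value_lineThrough]; ring

@[simp] theorem value_lineThrough_right (x y : Fin 3 → ℝ) : value y (lineThrough x y) = 0 := by
  rw [value_lineThrough]; ring

theorem value_lineThrough_swap (x y z : Fin 3 → ℝ) :
    value y (lineThrough x z) = -value z (lineThrough x y) := by
  simp only [value_lineThrough]; ring

theorem lineThrough_ne_zero {x y : Fin 3 → ℝ} (h : LinearIndependent ℝ ![x, y]) :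
    lineThrough x y ≠ 0 := by
  intro h0
  have hz (z : Fin 3 → ℝ) : value z (lineThrough x y) = 0 := by rw [h0, value_zero]
  refine crossProduct_ne_zero_iff_linearIndependent.2 h ?_
  have h0 := hz ![1, 0, 0]
  have h1 := hz ![0, 1, 0]
  have h2 := hz ![0, 0, 1]
  simp only [value_lineThrough, Matrix.cons_val, mul_zero, mul_one, add_zero, zero_add] at h0 h1 h2
  rw [cross_apply, h0, h1, h2]
  ext i
  fin_cases i <;> rfl

/-- The vectors of a family are pairwise linearly independent: they represent nonzero, pairwise
distinct points of the projective space. -/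
def PairwiseIndep {k : ℕ} (v : Fin k → Fin 3 → ℝ) : Prop :=
  ∀ i j, i ≠ j → LinearIndependent ℝ ![v i, v j]

theorem PairwiseIndep.of_injective {k : ℕ} {v : Fin k → Fin 3 → ℝ} (hv : ∀ i, v i ≠ 0)
    (hinj : Function.Injective fun i => Projectivization.mk ℝ (v i) (hv i)) : PairwiseIndep v := by
  intro _ _ hij
  by_contra h
  refine hij (hinj ?_)
  rw [LinearIndependent.pair_iff' (hv _)] at h
  push Not at h
  obtain ⟨a, ha⟩ := h
  exact ((Projectivization.mk_eq_mk_iff' ℝ _ _ (hv _) (hv _)).2 (by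
    refine ⟨a⁻¹, ?_⟩
    have : a ≠ 0 := by rintro rfl; exact hv _ (by rw [← ha, zero_smul])
    rw [← ha, smul_smul, inv_mul_cancel₀ this, one_smul]))

theorem PairwiseIndep.comp {k m : ℕ} {v : Fin k → Fin 3 → ℝ} (hv : PairwiseIndep v)
    (s : Fin m → Fin k) (hs : Function.Injective s) : PairwiseIndep (v ∘ s) :=
  fun _ _ hij => hv _ _ (hs.ne hij)

theorem IsGeneric.comp {k m : ℕ} {v : Fin k → Fin 3 → ℝ} (hv : IsGeneric v)
    (s : Fin m → Fin k) (hs : Function.Injective s) : IsGeneric (v ∘ s) := by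
  constructor
  · rintro t ht ⟨f, hf, h⟩
    exact hv.1 (t.map ⟨s, hs⟩) (by simpa using ht) ⟨f, hf, by simpa using h⟩
  · rintro t ht ⟨f, hf, h⟩
    exact hv.2 (t.map ⟨s, hs⟩) (by simpa using ht) ⟨f, hf, by simpa using h⟩

/-! ### Conics through four and five points -/

section Generic

variable {k : ℕ} {v : Fin k → Fin 3 → ℝ}

/-- Two distinct lines, each spanned by `v a` and a further point, meet in `v a` only. -/
theorem not_collinear_both (hind : PairwiseIndep v) (hgen : IsGeneric v) {a b c p : Fin k}
    (hab : a ≠ b) (hac : a ≠ c) (hbc : b ≠ c) (hpa : p ≠ a) (hpb : p ≠ b) (hpc : p ≠ c)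
    (h₁ : value (v p) (lineThrough (v a) (v b)) = 0)
    (h₂ : value (v p) (lineThrough (v a) (v c)) = 0) : False := by
  refine hgen.1 {a, b, c, p} ?_
    ⟨lineThrough (v a) (v p), lineThrough_ne_zero (hind _ _ hpa.symm), ?_⟩
  · grind
  · simp [value_lineThrough_swap (v a) (v b) (v p),
      value_lineThrough_swap (v a) (v c) (v p), h₁, h₂]

/-- For four points in general position and a fifth one, one of the three pairs of lines through
the four points avoids the fifth. -/
theorem exists_quadric_through_four (hind : PairwiseIndep v) (hgen : IsGeneric v)
    {a b c d p : Fin k} (hnd : [a, b, c, d, p].Nodup) :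
    ∃ f : Form 3 2, value (v p) f ≠ 0 ∧ value (v a) f = 0 ∧ value (v b) f = 0 ∧
      value (v c) f = 0 ∧ value (v d) f = 0 := by
  simp only [List.nodup_cons, List.mem_cons, List.not_mem_nil, or_false, not_or] at hnd
  obtain ⟨⟨hab, hac, had, hap⟩, ⟨hbc, hbd, hbp⟩, ⟨hcd, hcp⟩, hdp, -⟩ := hnd
  by_cases h : value (v p) (lineThrough (v a) (v b)) * value (v p) (lineThrough (v c) (v d)) = 0
  -- Two of the three pairings suffice: `ab` and `cd` each meet `ac` and `bd` in one of the four
  -- points, so `p` on a line of both pairings would give four collinear points.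
  · refine ⟨mulForm (show 1 + 1 = 2 from rfl) (lineThrough (v a) (v c)) (lineThrough (v b) (v d)), ?_, ?_⟩
    · rw [value_mulForm]
      have sw (x y z : Fin 3 → ℝ) : value z (lineThrough x y) = 0 →
          value z (lineThrough y x) = 0 := by
        simp only [value_lineThrough]; intro h; linear_combination -h
      intro h'
      rcases mul_eq_zero.1 h with h | h <;> rcases mul_eq_zero.1 h' with h' | h'
      · exact not_collinear_both hind hgen hab hac hbc (Ne.symm hap) (Ne.symm hbp) (Ne.symm hcp) h h'
      · exact not_collinear_both hind hgen (Ne.symm hab) hbd had (Ne.symm hbp) (Ne.symm hap)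
          (Ne.symm hdp) (sw _ _ _ h) h'
      · exact not_collinear_both hind hgen hcd (Ne.symm hac) (Ne.symm had) (Ne.symm hcp)
          (Ne.symm hdp) (Ne.symm hap) h (sw _ _ _ h')
      · exact not_collinear_both hind hgen (Ne.symm hcd) (Ne.symm hbd) (Ne.symm hbc) (Ne.symm hdp)
          (Ne.symm hcp) (Ne.symm hbp) (sw _ _ _ h) (sw _ _ _ h')
    · simp
  · exact ⟨mulForm (show 1 + 1 = 2 from rfl) (lineThrough (v a) (v b)) (lineThrough (v c) (v d)),
      by rwa [value_mulForm], by simp⟩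

theorem surjective_of_separates {m d : ℕ} {w : Fin m → Fin 3 → ℝ}
    (h : ∀ i, ∃ f : Form 3 d, value (w i) f ≠ 0 ∧ ∀ j, j ≠ i → value (w j) f = 0) :
    Function.Surjective (evalAt d w) := by
  choose f hf hf' using h
  intro x
  refine ⟨∑ i, (x i / value (w i) (f i)) • f i, ?_⟩
  ext j
  rw [map_sum, Finset.sum_apply, Finset.sum_eq_single j]
  · simp [hf j]
  · intro i _ hij
    simp [hf' i j hij.symm]
  · simp

theorem exists_generator_of_finrank_ker_eq_one {E F : Type*} [AddCommGroup E] [Module ℝ E]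
    [AddCommGroup F] [Module ℝ F] (T : E →ₗ[ℝ] F)
    (hT : Module.finrank ℝ (LinearMap.ker T) = 1) :
    ∃ x : E, x ≠ 0 ∧ T x = 0 ∧ ∀ y, T y = 0 → ∃ c : ℝ, c • x = y := by
  obtain ⟨⟨x, hx⟩, hx0, h⟩ := finrank_eq_one_iff'.1 hT
  refine ⟨x, by simpa using hx0, hx, fun y hy => ?_⟩
  obtain ⟨c, hc⟩ := h ⟨y, hy⟩
  exact ⟨c, congrArg Subtype.val hc⟩

/-- Five points, no four of them on a line, lie on exactly one quadric. -/
theorem exists_unique_quadric_through_five (hind : PairwiseIndep v) (hgen : IsGeneric v)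
    (s : Fin 5 → Fin k) (hs : Function.Injective s) :
    ∃ q : Form 3 2, q ≠ 0 ∧ (∀ i, value (v (s i)) q = 0) ∧
      ∀ q' : Form 3 2, (∀ i, value (v (s i)) q' = 0) → ∃ c : ℝ, c • q = q' := by
  have hsurj : Function.Surjective (evalAt 2 (v ∘ s)) := by
    refine surjective_of_separates fun i => ?_
    obtain ⟨f, hp, ha, hb, hc, hd⟩ := exists_quadric_through_four (hind.comp s hs)
      (hgen.comp s hs) (a := i.succAbove 0) (b := i.succAbove 1) (c := i.succAbove 2)
      (d := i.succAbove 3) (p := i) (by revert i; decide)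
    refine ⟨f, hp, fun j hj => ?_⟩
    obtain ⟨j, rfl⟩ := Fin.exists_succAbove_eq hj
    fin_cases j <;> assumption
  have h := LinearMap.finrank_range_add_finrank_ker (evalAt 2 (v ∘ s))
  rw [LinearMap.range_eq_top.2 hsurj, finrank_top, finrank_form, Module.finrank_fintype_fun_eq_card,
    Fintype.card_fin] at h
  norm_num [Nat.choose] at h
  obtain ⟨q, hq, hq0, hu⟩ := exists_generator_of_finrank_ker_eq_one (evalAt 2 (v ∘ s)) (by omega)
  exact ⟨q, hq, congrFun hq0, fun q' h => hu q' (funext h)⟩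

end Generic

/-! ### Eight points and cubics -/

section EightPoints

variable {v : Fin 8 → Fin 3 → ℝ}

/-- Otherwise line-plus-conic cubics force the conic through 3, 4, 5, 6, 7 and the one through 2, 4,
5, 6, 7 to pass through 0. Both then contain 0, 4, 5, 6, 7, hence coincide, and seven points lie on
a conic. -/
theorem exists_cubic_of_good_pairs (hind : PairwiseIndep v) (hgen : IsGeneric v)
    (hb : value (v 0) (lineThrough (v 1) (v 2)) ≠ 0)
    (hc : value (v 0) (lineThrough (v 1) (v 3)) ≠ 0) :
    ∃ q : Form 3 3, value (v 0) q ≠ 0 ∧ ∀ i, i ≠ 0 → value (v i) q = 0 := by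
  by_contra! hcon
  obtain ⟨q₁, hq₁, hz₁, -⟩ :=
    exists_unique_quadric_through_five hind hgen ![3, 4, 5, 6, 7] (by decide)
  obtain ⟨q₂, hq₂, hz₂, -⟩ :=
    exists_unique_quadric_through_five hind hgen ![2, 4, 5, 6, 7] (by decide)
  simp only [Fin.forall_fin_succ] at hz₁ hz₂
  simp only [Matrix.cons_val_zero, Matrix.cons_val_succ, IsEmpty.forall_iff, and_true] at hz₁ hz₂
  obtain ⟨h13, h14, h15, h16, h17⟩ := hz₁
  obtain ⟨h22, h24, h25, h26, h27⟩ := hz₂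
  have hp₁ : value (v 0) q₁ = 0 := by
    by_contra h
    obtain ⟨i, hi, hi'⟩ := hcon (mulForm (show 1 + 2 = 3 from rfl) (lineThrough (v 1) (v 2)) q₁)
      (by rw [value_mulForm]; exact mul_ne_zero hb h)
    rw [value_mulForm] at hi'
    fin_cases i <;> simp_all
  have hp₂ : value (v 0) q₂ = 0 := by
    by_contra h
    obtain ⟨i, hi, hi'⟩ := hcon (mulForm (show 1 + 2 = 3 from rfl) (lineThrough (v 1) (v 3)) q₂)
      (by rw [value_mulForm]; exact mul_ne_zero hc h)
    rw [value_mulForm] at hi'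
    fin_cases i <;> simp_all
  obtain ⟨q, hq, -, huniq⟩ :=
    exists_unique_quadric_through_five hind hgen ![0, 4, 5, 6, 7] (by decide)
  obtain ⟨c₁, hc₁⟩ := huniq q₁ (by intro i; fin_cases i <;> assumption)
  obtain ⟨c₂, hc₂⟩ := huniq q₂ (by intro i; fin_cases i <;> assumption)
  have hne : c₂ ≠ 0 := by
    rintro rfl
    exact hq₂ (by rw [← hc₂, zero_smul])
  have h2 : value (v 2) q = 0 := by
    rw [← hc₂, value_smul_form] at h22
    exact (mul_eq_zero.1 h22).resolve_left hne
  have h12 : value (v 2) q₁ = 0 := by rw [← hc₁, value_smul_form, h2, mul_zero]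
  refine hgen.2 {2, 3, 4, 5, 6, 7, 0} (by decide) ⟨q₁, hq₁, ?_⟩
  simp [*]

/-- Eight points, no four of them on a line and no seven on a quadric, impose independent
conditions on cubics. -/
theorem exists_cubic_through_seven (hind : PairwiseIndep v) (hgen : IsGeneric v) :
    ∃ q : Form 3 3, value (v 0) q ≠ 0 ∧ ∀ i, i ≠ 0 → value (v i) q = 0 := by
  -- At most one line joining `v 1` to another of the points `v 2, …, v 7` contains `v 0`, so
  -- relabelling yields two good pairs.
  have two (x y : Fin 8) (h1x : 1 ≠ x) (h1y : 1 ≠ y) (hxy : x ≠ y) (h0x : 0 ≠ x) (h0y : 0 ≠ y)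
      (h₁ : value (v 0) (lineThrough (v 1) (v x)) = 0) :
      value (v 0) (lineThrough (v 1) (v y)) ≠ 0 :=
    fun h₂ => not_collinear_both hind hgen h1x h1y hxy (by decide) h0x h0y h₁ h₂
  have perm (s : Fin 8 → Fin 8) (hs : Function.Injective s) (h0 : s 0 = 0)
      (hb : value (v (s 0)) (lineThrough (v (s 1)) (v (s 2))) ≠ 0)
      (hc : value (v (s 0)) (lineThrough (v (s 1)) (v (s 3))) ≠ 0) :
      ∃ q : Form 3 3, value (v 0) q ≠ 0 ∧ ∀ i, i ≠ 0 → value (v i) q = 0 := by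
    obtain ⟨q, hq, h⟩ := exists_cubic_of_good_pairs (hind.comp s hs) (hgen.comp s hs) hb hc
    refine ⟨q, by simpa [h0] using hq, fun i hi => ?_⟩
    obtain ⟨j, rfl⟩ := (Finite.injective_iff_surjective.1 hs) i
    exact h j (by rintro rfl; exact hi h0)
  by_cases hb : value (v 0) (lineThrough (v 1) (v 2)) = 0
  · exact perm ![0, 1, 3, 4, 2, 5, 6, 7] (by decide) rfl
      (two 2 3 (by decide) (by decide) (by decide) (by decide) (by decide) hb)
      (two 2 4 (by decide) (by decide) (by decide) (by decide) (by decide) hb)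
  by_cases hc : value (v 0) (lineThrough (v 1) (v 3)) = 0
  · exact perm ![0, 1, 2, 4, 3, 5, 6, 7] (by decide) rfl hb
      (two 3 4 (by decide) (by decide) (by decide) (by decide) (by decide) hc)
  exact exists_cubic_of_good_pairs hind hgen hb hc

end EightPoints

/-! ### Syzygies of two coprime cubics -/

/-- The map `(a, b) ↦ a * q₁ + b * q₂` on pairs of cubics. -/
noncomputable def cubicCombination (q₁ q₂ : Form 3 3) : Form 3 3 × Form 3 3 →ₗ[ℝ] Form 3 (2 * 3) :=
  ((mulForm rfl).flip q₁).coprod ((mulForm rfl).flip q₂)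

theorem cubicCombination_apply (q₁ q₂ a b : Form 3 3) :
    cubicCombination q₁ q₂ (a, b) = mulForm rfl a q₁ + mulForm rfl b q₂ := rfl

section Coprime

variable {q₁ q₂ : Form 3 3}
  (hq : IsRelPrime (q₁ : MvPolynomial (Fin 3) ℝ) (q₂ : MvPolynomial (Fin 3) ℝ))

theorem exists_eq_smul_of_dvd {a b : Form 3 3}
    (h : (b : MvPolynomial (Fin 3) ℝ) ∣ (a : MvPolynomial (Fin 3) ℝ)) : ∃ c : ℝ, a = c • b := by
  obtain ⟨c, hc⟩ := h
  rcases eq_or_ne (a : MvPolynomial (Fin 3) ℝ) 0 with ha | ha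
  · exact ⟨0, by ext1; simp [ha]⟩
  · have hb : (b : MvPolynomial (Fin 3) ℝ) ≠ 0 := fun h => ha (by rw [hc, h, zero_mul])
    have hc0 : c ≠ 0 := fun h => ha (by rw [hc, h, mul_zero])
    have hdeg := MvPolynomial.totalDegree_mul_of_isDomain hb hc0
    rw [← hc, MvPolynomial.IsHomogeneous.totalDegree a.2 ha,
      MvPolynomial.IsHomogeneous.totalDegree b.2 hb] at hdeg
    have : c.totalDegree = 0 := by omega
    rw [MvPolynomial.totalDegree_eq_zero_iff_eq_C] at this
    refine ⟨MvPolynomial.coeff 0 c, ?_⟩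
    ext1
    rw [hc, this]
    simp [MvPolynomial.smul_eq_C_mul, mul_comm]

include hq

theorem ne_zero_of_isRelPrime : q₁ ≠ 0 := by
  rintro rfl
  have hu : IsUnit (q₂ : MvPolynomial (Fin 3) ℝ) := hq (by simp) dvd_rfl
  have h0 := hu.ne_zero
  have := MvPolynomial.IsHomogeneous.totalDegree q₂.2 h0
  rw [MvPolynomial.isUnit_iff_eq_C_of_isReduced] at hu
  obtain ⟨r, -, hr⟩ := hu
  rw [hr, MvPolynomial.totalDegree_C] at this
  omega

theorem linearIndependent_of_isRelPrime : LinearIndependent ℝ ![q₁, q₂] := by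
  rw [LinearIndependent.pair_iff' (ne_zero_of_isRelPrime hq)]
  intro c hc
  have hu : IsUnit (q₁ : MvPolynomial (Fin 3) ℝ) := hq dvd_rfl
    ⟨MvPolynomial.C c, by rw [← hc]; simp [MvPolynomial.smul_eq_C_mul, mul_comm]⟩
  have h0 := hu.ne_zero
  have := MvPolynomial.IsHomogeneous.totalDegree q₁.2 h0
  rw [MvPolynomial.isUnit_iff_eq_C_of_isReduced] at hu
  obtain ⟨r, -, hr⟩ := hu
  rw [hr, MvPolynomial.totalDegree_C] at this
  omega

/-- Only the Koszul syzygy exists in this degree: coprimality gives `q₂ ∣ a`, and equal degrees make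
the quotient a scalar. -/
theorem finrank_ker_cubicCombination_le :
    Module.finrank ℝ (LinearMap.ker (cubicCombination q₁ q₂)) ≤ 1 := by
  have hle : LinearMap.ker (cubicCombination q₁ q₂) ≤ Submodule.span ℝ {(q₂, -q₁)} := by
    rintro ⟨a, b⟩ hab
    have h : (a : MvPolynomial (Fin 3) ℝ) * q₁ + b * q₂ = 0 :=
      congrArg Subtype.val (LinearMap.mem_ker.1 hab)
    obtain ⟨c, rfl⟩ : ∃ c : ℝ, a = c • q₂ := exists_eq_smul_of_dvd <|
      hq.symm.dvd_of_dvd_mul_right ⟨-b, by linear_combination h⟩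
    have hq₂ : (q₂ : MvPolynomial (Fin 3) ℝ) ≠ 0 := by
      simpa using ne_zero_of_isRelPrime hq.symm
    refine Submodule.mem_span_singleton.2 ⟨c, Prod.ext rfl (Subtype.ext ?_)⟩
    refine mul_right_cancel₀ hq₂ ?_
    simp only [Submodule.coe_smul, MvPolynomial.smul_eq_C_mul, Prod.smul_mk,
      Submodule.coe_neg] at h ⊢
    linear_combination -h
  refine (Submodule.finrank_mono hle).trans (finrank_span_singleton fun h => ?_).le
  exact ne_zero_of_isRelPrime hq.symm (congrArg Prod.fst h)

end Coprime

/-! ### Cayley–Bacharach and Max Noether at nine points -/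

section NinePoints

variable {v : Fin 9 → Fin 3 → ℝ}

theorem exists_cubic_separating (hind : PairwiseIndep v) (hgen : IsGeneric v) {i j : Fin 9}
    (hij : i ≠ j) :
    ∃ q : Form 3 3, value (v i) q = 1 ∧ ∀ k, k ≠ i → k ≠ j → value (v k) q = 0 := by
  obtain ⟨m, rfl⟩ := Fin.exists_succAbove_eq hij
  have hs : Function.Injective (j.succAbove ∘ Equiv.swap 0 m) :=
    Fin.succAbove_right_injective.comp (Equiv.injective _)
  obtain ⟨q, hq, h⟩ := exists_cubic_through_seven (hind.comp _ hs) (hgen.comp _ hs)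
  simp only [Function.comp_apply, Equiv.swap_apply_left] at hq
  refine ⟨(value (v (j.succAbove m)) q)⁻¹ • q, by simp [hq], fun k hk hkj => ?_⟩
  obtain ⟨l, rfl⟩ := Fin.exists_succAbove_eq hkj
  have := h (Equiv.swap 0 m l) (by
    intro h0
    rw [Equiv.swap_apply_eq_iff, Equiv.swap_apply_left] at h0
    exact hk (by rw [h0]))
  simp only [Function.comp_apply, Equiv.swap_apply_self] at this
  simp [this]

/-- The coefficients `u` are all nonzero, and the relation `∑ i, u i * f (v i) = 0` characterizes
the families of values of cubics `f` at the nine points. -/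
structure IsCubicRelation (v : Fin 9 → Fin 3 → ℝ) (u : Fin 9 → ℝ) : Prop where
  ne_zero : ∀ i, u i ≠ 0
  mem_range_iff : ∀ x : Fin 9 → ℝ, (∃ f : Form 3 3, ∀ i, value (v i) f = x i) ↔ ∑ i, u i * x i = 0

theorem exists_isCubicRelation (hind : PairwiseIndep v) (hgen : IsGeneric v) {q₁ q₂ : Form 3 3}
    (hq : IsRelPrime (q₁ : MvPolynomial (Fin 3) ℝ) (q₂ : MvPolynomial (Fin 3) ℝ))
    (h₁ : ∀ i, value (v i) q₁ = 0) (h₂ : ∀ i, value (v i) q₂ = 0) :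
    ∃ u, IsCubicRelation v u := by
  -- Surjectivity would leave a kernel of dimension 10 − 9 = 1, too small for the pencil of `q₁` and
  -- `q₂`.
  have hlt : LinearMap.range (evalAt 3 v) < ⊤ := by
    refine lt_top_iff_ne_top.2 fun htop => ?_
    have hle : Submodule.span ℝ (Set.range ![q₁, q₂]) ≤ LinearMap.ker (evalAt 3 v) := by
      rw [Submodule.span_le]
      rintro _ ⟨i, rfl⟩
      rw [SetLike.mem_coe, LinearMap.mem_ker]
      ext j
      fin_cases i
      · exact h₁ j
      · exact h₂ j
    have h2 := Submodule.finrank_mono hle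
    rw [finrank_span_eq_card (linearIndependent_of_isRelPrime hq), Fintype.card_fin] at h2
    have h := LinearMap.finrank_range_add_finrank_ker (evalAt 3 v)
    rw [htop, finrank_top, finrank_form, Module.finrank_fintype_fun_eq_card,
      Fintype.card_fin] at h
    norm_num [Nat.choose] at h
    omega
  obtain ⟨φ, hφ, hle⟩ := Submodule.exists_le_ker_of_lt_top _ hlt
  set u : Fin 9 → ℝ := fun i => φ (Pi.single i 1) with hu
  have hφu (x : Fin 9 → ℝ) : φ x = ∑ i, u i * x i := by
    rw [LinearMap.pi_apply_eq_sum_univ φ x]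
    refine Finset.sum_congr rfl fun i _ => ?_
    rw [smul_eq_mul, mul_comm, hu]
    congr 2
    ext j
    simp [Pi.single_apply, eq_comm]
  have hrel (f : Form 3 3) : ∑ i, u i * value (v i) f = 0 := by
    exact (hφu (evalAt 3 v f)).symm.trans (LinearMap.mem_ker.1 (hle ⟨f, rfl⟩))
  -- If `u j = 0`, a cubic vanishing at all points but `v i` and `v j` gives `u i = 0`, so the whole
  -- relation is trivial.
  have hne (j : Fin 9) : u j ≠ 0 := by
    intro hj
    refine hφ (LinearMap.ext fun x => ?_)
    rw [hφu, LinearMap.zero_apply]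
    refine Finset.sum_eq_zero fun i _ => ?_
    suffices u i = 0 by rw [this, zero_mul]
    by_cases hij : i = j
    · rw [hij, hj]
    obtain ⟨q, hq1, hq0⟩ := exists_cubic_separating hind hgen hij
    have := hrel q
    rw [Finset.sum_eq_single i, hq1, mul_one] at this
    · exact this
    · intro k _ hk
      by_cases hkj : k = j
      · rw [hkj, hj, zero_mul]
      · rw [hq0 k hk hkj, mul_zero]
    · simp
  refine ⟨u, hne, fun x => ⟨?_, fun hx => ?_⟩⟩
  · rintro ⟨f, hf⟩
    simpa only [hf] using hrel f
  -- Interpolate at the first eight points; the relation dictates the ninth value.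
  · choose g hg1 hg0 using fun i : Fin 8 =>
      exists_cubic_separating hind hgen (i := i.castSucc) (j := Fin.last 8) (Fin.castSucc_ne_last i)
    set f : Form 3 3 := ∑ i, x i.castSucc • g i with hf
    have hval (k : Fin 8) : value (v k.castSucc) f = x k.castSucc := by
      change evalAt 3 v f k.castSucc = _
      rw [hf, map_sum, Finset.sum_apply, Finset.sum_eq_single k]
      · simp [hg1]
      · intro i _ hik
        have := hg0 i k.castSucc (by simpa using hik.symm) (Fin.castSucc_ne_last k)
        simp [this]
      · simp
    refine ⟨f, Fin.lastCases ?_ hval⟩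
    have h := hrel f
    rw [Fin.sum_univ_castSucc] at h hx
    simp only [hval] at h
    exact mul_left_cancel₀ (hne (Fin.last 8)) (by linear_combination h - hx)

/-- These two-point vectors span the hyperplane and serve as test cubics below. -/
theorem IsCubicRelation.exists_cubic {u : Fin 9 → ℝ} (hu : IsCubicRelation v u) {i j : Fin 9}
    (hij : i ≠ j) :
    ∃ f : Form 3 3, value (v i) f = u j ∧ value (v j) f = -u i ∧
      ∀ k, k ≠ i → k ≠ j → value (v k) f = 0 := by
  obtain ⟨f, hf⟩ := (hu.mem_range_iff (Pi.single i (u j) - Pi.single j (u i))).2 (by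
    simp [Pi.single_apply, mul_sub, Finset.sum_sub_distrib, mul_comm])
  refine ⟨f, ?_, ?_, fun k hki hkj => ?_⟩
  · simp [hf, hij]
  · simp [hf, hij.symm]
  · simp [hf, hki, hkj]

/-- Among the nine points, two cubics living on `{i, i + 1}` and `{i, i + 2}` have a product living
on `i` alone. -/
theorem IsCubicRelation.surjective_evalAt_sextic {u : Fin 9 → ℝ} (hu : IsCubicRelation v u) :
    Function.Surjective (evalAt (2 * 3) v) := by
  refine surjective_of_separates fun i => ?_
  obtain ⟨f, hfi, hfj, hf⟩ := hu.exists_cubic (i := i) (j := i + 1) (by simp)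
  obtain ⟨g, hgi, hgj, hg⟩ := hu.exists_cubic (i := i) (j := i + 2)
    (by rw [ne_eq, left_eq_add]; decide)
  refine ⟨mulForm rfl f g, ?_, fun k hk => ?_⟩
  · rw [value_mulForm, hfi, hgi]
    exact mul_ne_zero (hu.ne_zero _) (hu.ne_zero _)
  · rw [value_mulForm]
    by_cases hk1 : k = i + 1
    · rw [hg k hk (by rw [hk1, ne_eq, add_right_inj]; decide), mul_zero]
    · rw [hf k hk hk1, zero_mul]

/-- Max Noether's theorem for sextics and a complete intersection of two cubics in nine points. -/
theorem ker_evalAt_sextic_eq {u : Fin 9 → ℝ} (hu : IsCubicRelation v u) {q₁ q₂ : Form 3 3}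
    (hq : IsRelPrime (q₁ : MvPolynomial (Fin 3) ℝ) (q₂ : MvPolynomial (Fin 3) ℝ))
    (h₁ : ∀ i, value (v i) q₁ = 0) (h₂ : ∀ i, value (v i) q₂ = 0) :
    LinearMap.range (cubicCombination q₁ q₂) = LinearMap.ker (evalAt (2 * 3) v) := by
  refine Submodule.eq_of_le_of_finrank_le ?_ ?_
  · rintro _ ⟨⟨a, b⟩, rfl⟩
    rw [LinearMap.mem_ker]
    ext i
    rw [cubicCombination_apply]
    simp [h₁, h₂]
  -- The kernel has dimension 28 − 9 = 19, the range at least 20 − 1.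
  · have h := LinearMap.finrank_range_add_finrank_ker (evalAt (2 * 3) v)
    rw [LinearMap.range_eq_top.2 hu.surjective_evalAt_sextic, finrank_top, finrank_form,
      Module.finrank_fintype_fun_eq_card, Fintype.card_fin] at h
    have h' := LinearMap.finrank_range_add_finrank_ker (cubicCombination q₁ q₂)
    rw [Module.finrank_prod, finrank_form] at h'
    have := finrank_ker_cubicCombination_le hq
    norm_num [Nat.choose] at h h'
    omega

end NinePoints

/-! ### The dual cone and point functionals -/

section Dual

variable {n d : ℕ}

theorem mem_sosDual {l : Module.Dual ℝ (Form n (2 * d))} :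
    l ∈ sosDual n d ↔ ∀ g : Form n d, 0 ≤ l (mulForm (two_mul d).symm g g) := by
  rw [sosDual, PointedCone.mem_dual]
  constructor
  · intro h g
    exact h (x := mulForm (two_mul d).symm g g) ⟨1, fun _ => g, by simp [sq]⟩
  · rintro h f ⟨r, g, hf⟩
    have : f = ∑ i, mulForm (two_mul d).symm (g i) (g i) := by
      ext1
      simp [hf, sq]
    rw [this, Module.Dual.eval_apply, map_sum]
    exact Finset.sum_nonneg fun i _ => h (g i)

theorem mulForm_comm {m : ℕ} (h : d + d = m) (f g : Form n d) : mulForm h f g = mulForm h g f := by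
  ext1
  simp [mul_comm]

/-- The Cauchy–Schwarz inequality, for an isotropic form. -/
theorem apply_mulForm_eq_zero {l : Module.Dual ℝ (Form n (2 * d))} (hl : l ∈ sosDual n d)
    {g : Form n d} (hg : l (mulForm (two_mul d).symm g g) = 0) (f : Form n d) :
    l (mulForm (two_mul d).symm f g) = 0 := by
  by_contra hne
  set b := l (mulForm (two_mul d).symm f g) with hb
  set c := l (mulForm (two_mul d).symm f f) with hc
  -- This multiple of `g` makes the value at the square equal to `c - (c + 1) = -1`.
  have h := mem_sosDual.1 hl (f + (-(c + 1) / (2 * b)) • g)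
  simp only [map_add, map_smul, LinearMap.add_apply, LinearMap.smul_apply, smul_eq_mul, hg,
    mulForm_comm _ g f, ← hb, ← hc] at h
  have h2 : -(c + 1) / (2 * b) * b = -(c + 1) / 2 := by field_simp
  rw [h2] at h
  linarith

@[simp] theorem pointFunctional_apply {k : ℕ} (v : Fin k → Fin n → ℝ) (a : Fin k → ℝ)
    (f : Form n d) : pointFunctional v a f = ∑ j, a j * value (v j) f := rfl

end Dual

theorem exists_eq_pointFunctional {n d k : ℕ} {v : Fin k → Fin n → ℝ}
    (hsurj : Function.Surjective (evalAt d v)) {l : Module.Dual ℝ (Form n d)}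
    (hl : LinearMap.ker (evalAt d v) ≤ LinearMap.ker l) : ∃ b, l = pointFunctional v b := by
  choose f hf using fun j => hsurj (Pi.single j 1)
  refine ⟨fun j => l (f j), LinearMap.ext fun g => ?_⟩
  have hg : g - ∑ j, value (v j) g • f j ∈ LinearMap.ker (evalAt d v) := by
    rw [LinearMap.mem_ker, map_sub, map_sum]
    ext i
    simp only [map_smul, hf]
    simp [Finset.sum_apply, Pi.single_apply]
  have := LinearMap.mem_ker.1 (hl hg)
  rw [map_sub, map_sum, sub_eq_zero] at this
  rw [this, pointFunctional_apply]
  exact Finset.sum_congr rfl fun j _ => by rw [map_smul, smul_eq_mul, mul_comm]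

/-! ### Extreme rays from degenerate diagonal forms -/

/-- A diagonal quadratic form with exactly one negative coefficient is nonnegative on a hyperplane
`u^⊥` to which it restricts with a degenerate form. -/
theorem sum_mul_sq_nonneg {k : ℕ} {a u x : Fin k → ℝ} {m : Fin k} (hpos : ∀ i, i ≠ m → 0 < a i)
    (hneg : a m < 0) (hum : u m ≠ 0) (ha : ∑ i, u i ^ 2 / a i = 0) (hx : ∑ i, u i * x i = 0) :
    0 ≤ ∑ i, a i * x i ^ 2 := by
  -- Cauchy–Schwarz off `m`: by `hx` and `ha` it reads `(u m * x m) ^ 2 ≤ u m ^ 2 / (-a m) * S`,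
  -- with `S` the positive part of the form.
  have hcs := Finset.sum_sq_le_sum_mul_sum_of_sq_le_mul (Finset.univ.erase m)
    (r := fun i => u i * x i) (f := fun i => u i ^ 2 / a i) (g := fun i => a i * x i ^ 2)
    (fun i hi => div_nonneg (sq_nonneg _) (hpos i (Finset.ne_of_mem_erase hi)).le)
    (fun i hi => mul_nonneg (hpos i (Finset.ne_of_mem_erase hi)).le (sq_nonneg _))
    (fun i hi => by
      have := (hpos i (Finset.ne_of_mem_erase hi)).ne'
      refine le_of_eq ?_
      field_simp)
  rw [← Finset.add_sum_erase _ _ (Finset.mem_univ m)] at ha hx ⊢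
  rw [eq_neg_of_add_eq_zero_right ha, eq_neg_of_add_eq_zero_right hx] at hcs
  set S := ∑ i ∈ Finset.univ.erase m, a i * x i ^ 2
  have hc : 0 < u m ^ 2 / (-a m) := div_pos (by positivity) (by linarith)
  have : u m ^ 2 / (-a m) * (a m * x m ^ 2) = -(u m * x m) ^ 2 := by
    have := hneg.ne
    field_simp
  refine nonneg_of_mul_nonneg_right (a := u m ^ 2 / (-a m)) ?_ hc
  rw [mul_add, this]
  have h2 : -(u m ^ 2 / a m) = u m ^ 2 / (-a m) := by rw [div_neg]
  rw [h2] at hcs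
  linarith [neg_sq (u m * x m)]

theorem IsCubicRelation.spansExtremeRay {v : Fin 9 → Fin 3 → ℝ} {u : Fin 9 → ℝ}
    (hu : IsCubicRelation v u) {q₁ q₂ : Form 3 3}
    (hq : IsRelPrime (q₁ : MvPolynomial (Fin 3) ℝ) (q₂ : MvPolynomial (Fin 3) ℝ))
    (h₁ : ∀ i, value (v i) q₁ = 0) (h₂ : ∀ i, value (v i) q₂ = 0)
    {a : Fin 9 → ℝ} {m : Fin 9} (hpos : ∀ i, i ≠ m → 0 < a i) (hneg : a m < 0)
    (ha : ∑ i, u i ^ 2 / a i = 0) :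
    SpansExtremeRay (sosDual 3 3) (pointFunctional v a) := by
  have hrel (f : Form 3 3) : ∑ i, u i * value (v i) f = 0 := (hu.mem_range_iff _).1 ⟨f, fun _ => rfl⟩
  have ha0 (i : Fin 9) : a i ≠ 0 := by
    by_cases hi : i = m
    · rw [hi]; exact hneg.ne
    · exact (hpos i hi).ne'
  have hmem : pointFunctional v a ∈ sosDual 3 3 := by
    refine mem_sosDual.2 fun g => ?_
    have := sum_mul_sq_nonneg hpos hneg (hu.ne_zero m) ha (hrel g)
    simpa [sq] using this
  -- A cubic vanishing at the negative point; its square shows that `l_a` is nonzero and later that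
  -- the scaling factor is nonnegative.
  obtain ⟨g, hgpos⟩ : ∃ g : Form 3 3, 0 < pointFunctional v a (mulForm (two_mul 3).symm g g) := by
    have h12 : m + 1 ≠ m + 2 := by rw [ne_eq, add_right_inj]; decide
    obtain ⟨g, hg1, hg2, hg⟩ := hu.exists_cubic h12
    refine ⟨g, ?_⟩
    rw [pointFunctional_apply]
    have hnn (j : Fin 9) : 0 ≤ a j * value (v j) (mulForm (two_mul 3).symm g g) := by
      rw [value_mulForm]
      by_cases hj : j = m
      · rw [hg j (by rw [hj]; simp) (by rw [hj]; simp), mul_zero, mul_zero]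
      · exact mul_nonneg (hpos j hj).le (mul_self_nonneg _)
    refine Finset.sum_pos' (fun j _ => hnn j) ⟨m + 1, Finset.mem_univ _, ?_⟩
    rw [value_mulForm, hg1]
    exact mul_pos (hpos _ (by simp)) (mul_self_pos.2 (hu.ne_zero _))
  refine ⟨hmem, fun h0 => ?_, fun l₁ hl₁ l₂ hl₂ hl => ?_⟩
  · rw [h0] at hgpos
    exact lt_irrefl _ hgpos
  -- The radical vector lies in the hyperplane exactly because of `ha`.
  obtain ⟨q₀, hq₀⟩ := (hu.mem_range_iff fun i => u i / a i).2 (by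
    rw [← ha]
    exact Finset.sum_congr rfl fun i _ => by ring)
  have hisotropic (q : Form 3 3) (hq : pointFunctional v a (mulForm (two_mul 3).symm q q) = 0)
      (f : Form 3 3) : l₁ (mulForm (two_mul 3).symm f q) = 0 := by
    refine apply_mulForm_eq_zero hl₁ ?_ f
    rw [← hl, LinearMap.add_apply] at hq
    linarith [mem_sosDual.1 hl₁ q, mem_sosDual.1 hl₂ q]
  have hi₀ := hisotropic q₀ (by
    rw [pointFunctional_apply, ← ha]
    refine Finset.sum_congr rfl fun i _ => ?_
    have := ha0 i
    rw [value_mulForm, hq₀]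
    field_simp)
  have hi₁ := hisotropic q₁ (by simp [h₁])
  have hi₂ := hisotropic q₂ (by simp [h₂])
  obtain ⟨b, rfl⟩ : ∃ b, l₁ = pointFunctional v b := by
    refine exists_eq_pointFunctional hu.surjective_evalAt_sextic ?_
    rw [← ker_evalAt_sextic_eq hu hq h₁ h₂]
    rintro _ ⟨⟨f₁, f₂⟩, rfl⟩
    rw [LinearMap.mem_ker, cubicCombination_apply, map_add, hi₁, hi₂, add_zero]
  -- Pairing `q₀` with a two-point cubic compares the ratios at `i` and `j`.
  have hratio (i j : Fin 9) : b i / a i = b j / a j := by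
    rcases eq_or_ne i j with rfl | hij
    · rfl
    obtain ⟨f, hfi, hfj, hf⟩ := hu.exists_cubic hij
    have h := hi₀ f
    rw [pointFunctional_apply, ← Finset.sum_subset (Finset.subset_univ {i, j}),
      Finset.sum_pair hij] at h
    · simp only [value_mulForm, hfi, hfj, hq₀] at h
      have := hu.ne_zero i
      have := hu.ne_zero j
      have : u i * u j * (b i / a i - b j / a j) = 0 := by linear_combination h
      simpa [hu.ne_zero, sub_eq_zero] using this
    · intro k _ hk
      simp only [Finset.mem_insert, Finset.mem_singleton, not_or] at hk
      rw [value_mulForm, hf k hk.1 hk.2, zero_mul, mul_zero]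
  have heq : pointFunctional v b = (b m / a m) • pointFunctional (d := 2 * 3) v a := by
    ext f
    rw [LinearMap.smul_apply, pointFunctional_apply, pointFunctional_apply, smul_eq_mul,
      Finset.mul_sum]
    refine Finset.sum_congr rfl fun i _ => ?_
    rw [hratio m i, ← mul_assoc, div_mul_cancel₀ _ (ha0 i)]
  refine ⟨b m / a m, ?_, heq⟩
  have h := mem_sosDual.1 hl₁ g
  rw [heq, LinearMap.smul_apply, smul_eq_mul] at h
  exact nonneg_of_mul_nonneg_left h hgpos

/-- With `a i = u i ^ 2 / w i` the degeneracy condition becomes `∑ i, w i = 0`. Taking `w k = u k ^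
2` and `ε` at the seven other points gives `a k = 1` and `a m = -u m ^ 2 / (u k ^ 2 + 7 * ε)`; a
small `ε` preserves the strict inequality. -/
theorem exists_weights {u : Fin 9 → ℝ} (hu : ∀ i, u i ≠ 0) {k m : Fin 9} (hkm : k ≠ m) {s t : ℝ}
    (hs : 0 < s) (h : u k ^ 2 * s < u m ^ 2 * t) :
    ∃ a : Fin 9 → ℝ, (∀ i, i ≠ m → 0 < a i) ∧ a m < 0 ∧ ∑ i, u i ^ 2 / a i = 0 ∧
      a k * s + a m * t < 0 := by
  have hsq (i : Fin 9) : 0 < u i ^ 2 := by have := hu i; positivity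
  obtain ⟨ε, hε, hεs⟩ : ∃ ε : ℝ, 0 < ε ∧ (u k ^ 2 + 7 * ε) * s < u m ^ 2 * t := by
    refine ⟨(u m ^ 2 * t - u k ^ 2 * s) / (8 * s), div_pos (by linarith) (by linarith), ?_⟩
    have : (u m ^ 2 * t - u k ^ 2 * s) / (8 * s) * s = (u m ^ 2 * t - u k ^ 2 * s) / 8 := by
      field_simp
    linarith
  set r : ℝ := u k ^ 2 + 7 * ε with hr
  have hr0 : 0 < r := by have := hsq k; positivity
  set w : Fin 9 → ℝ := fun i => if i = m then -r else if i = k then u k ^ 2 else ε with hw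
  have hwm : w m = -r := by simp [hw]
  have hwk : w k = u k ^ 2 := by simp [hw, hkm]
  have hwi (i : Fin 9) (hm : i ≠ m) (hk : i ≠ k) : w i = ε := by simp [hw, hm, hk]
  have hwpos (i : Fin 9) (hm : i ≠ m) : 0 < w i := by
    by_cases hk : i = k
    · rw [hk, hwk]; exact hsq k
    · rwa [hwi i hm hk]
  have hdiv (i : Fin 9) : u i ^ 2 / (u i ^ 2 / w i) = w i := div_div_cancel₀ (hsq i).ne'
  refine ⟨fun i => u i ^ 2 / w i, fun i hi => div_pos (hsq i) (hwpos i hi),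
    div_neg_of_pos_of_neg (hsq m) (by rw [hwm]; linarith), ?_, ?_⟩
  · simp only [hdiv]
    rw [← Finset.add_sum_erase _ _ (Finset.mem_univ m),
      ← Finset.add_sum_erase _ _ (Finset.mem_erase.2 ⟨hkm, Finset.mem_univ k⟩), hwm, hwk,
      Finset.sum_congr rfl fun i hi => hwi i (by grind) (by grind), Finset.sum_const,
      Finset.card_erase_of_mem (by simp [hkm]), Finset.card_erase_of_mem (Finset.mem_univ m)]
    simp
    linarith
  · simp only [hwm, hwk]
    rw [div_self (hsq k).ne', one_mul, div_neg, neg_mul, ← sub_eq_add_neg, sub_neg, div_mul_eq_mul_div,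
      lt_div_iff₀ hr0]
    linarith

end SosRays

/-! ### The certificate for `p` -/

open SosRays
theorem corollary4p2
    -- affine representatives of nine distinct points of the real projective plane;
    -- `v 7` and `v 8` are the two points that are not zeros of `p`
    (v : Fin 9 → Fin 3 → ℝ) (hv : ∀ i, v i ≠ 0)
    (hinj : Function.Injective fun i => Projectivization.mk ℝ (v i) (hv i))
    (hgen : IsGeneric v)
    (hcub : IsIntersectionOfCubics (Set.range fun i => Projectivization.mk ℝ (v i) (hv i)))
    (p : Form 3 (2 * 3)) (hpsd : p ∈ psdForms 3 3) (hsos : p ∉ sosForms 3 3)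
    (hzeros : projVariety p =
      (fun i => Projectivization.mk ℝ (v i) (hv i)) '' {i : Fin 9 | i.val < 7}) :
    (∃ h : Form 3 3, projVariety p ⊆ projVariety h ∧ value (v 7) h ≠ 0 ∧ value (v 8) h ≠ 0) ∧
    ∀ h : Form 3 3, projVariety p ⊆ projVariety h →
      value (v 8) h ^ 2 * value (v 7) p ≠ value (v 7) h ^ 2 * value (v 8) p →
      ∃ a : Fin 9 → ℝ,
        SpansExtremeRay (sosDual 3 3) (pointFunctional v a) ∧ pointFunctional v a p < 0 := by
  obtain ⟨q₁, q₂, hq, hA⟩ := hcub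
  have hind := PairwiseIndep.of_injective hv hinj
  have hzero (i : Fin 9) : value (v i) q₁ = 0 ∧ value (v i) q₂ = 0 := by
    rw [← mk_mem_projVariety q₁ _ (hv i), ← mk_mem_projVariety q₂ _ (hv i), ← Set.mem_inter_iff, hA]
    exact ⟨i, rfl⟩
  have h₁ (i : Fin 9) := (hzero i).1
  have h₂ (i : Fin 9) := (hzero i).2
  obtain ⟨u, hu⟩ := exists_isCubicRelation hind hgen hq h₁ h₂
  have hval (i : Fin 9) : value (v i) p = 0 ↔ i.val < 7 := by
    rw [← mk_mem_projVariety p _ (hv i), hzeros]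
    exact hinj.mem_set_image
  have hsub (h : Form 3 3) :
      projVariety p ⊆ projVariety h ↔ ∀ i : Fin 9, i.val < 7 → value (v i) h = 0 := by
    rw [hzeros, Set.image_subset_iff]
    exact forall₂_congr fun i _ => mk_mem_projVariety h _ (hv i)
  constructor
  · obtain ⟨f, hf7, hf8, hf⟩ := hu.exists_cubic (i := 7) (j := 8) (by decide)
    refine ⟨f, (hsub f).2 fun i hi => hf i ?_ ?_, ?_, ?_⟩
    · rintro rfl; revert hi; decide
    · rintro rfl; revert hi; decide
    · rw [hf7]; exact hu.ne_zero 8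
    · rw [hf8]; exact neg_ne_zero.2 (hu.ne_zero 7)
  · intro h hh hne
    have hp7 : 0 < value (v 7) p :=
      lt_of_le_of_ne (hpsd _) (Ne.symm (mt (hval 7).1 (by decide)))
    have hp8 : 0 < value (v 8) p :=
      lt_of_le_of_ne (hpsd _) (Ne.symm (mt (hval 8).1 (by decide)))
    have hsum (a : Fin 9 → ℝ) {d : ℕ} (f : Form 3 d)
        (hf : ∀ i : Fin 9, i.val < 7 → value (v i) f = 0) :
        ∑ i, a i * value (v i) f = a 7 * value (v 7) f + a 8 * value (v 8) f := by
      rw [← Finset.sum_subset (Finset.subset_univ {7, 8}), Finset.sum_pair (by decide)]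
      intro i _ hi
      rw [hf i (by revert i; decide), mul_zero]
    have hrel := (hu.mem_range_iff _).1 ⟨h, fun _ => rfl⟩
    rw [hsum u h ((hsub h).1 hh)] at hrel
    -- `hrel` reads `u 7 * h (v 7) + u 8 * h (v 8) = 0`, so equality here would contradict `hne`.
    have hcompare : u 7 ^ 2 * value (v 7) p ≠ u 8 ^ 2 * value (v 8) p := by
      intro heq
      have h8 : value (v 8) h = -(u 7 * value (v 7) h) / u 8 := by
        have := hu.ne_zero 8
        field_simp
        linear_combination hrel
      refine hne ?_
      rw [h8]
      have := hu.ne_zero 8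
      field_simp
      linear_combination value (v 7) h ^ 2 * heq
    have conclude (a : Fin 9 → ℝ) (m : Fin 9) (hpos : ∀ i, i ≠ m → 0 < a i) (hneg : a m < 0)
        (ha : ∑ i, u i ^ 2 / a i = 0) (hp : a 7 * value (v 7) p + a 8 * value (v 8) p < 0) :
        ∃ a : Fin 9 → ℝ,
          SpansExtremeRay (sosDual 3 3) (pointFunctional v a) ∧ pointFunctional v a p < 0 :=
      ⟨a, hu.spansExtremeRay hq h₁ h₂ hpos hneg ha, by
        rwa [pointFunctional_apply, hsum a p fun i => (hval i).2]⟩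
    rcases lt_or_gt_of_ne hcompare with hlt | hlt
    · obtain ⟨a, hpos, hneg, ha, hp⟩ := exists_weights hu.ne_zero (by decide) hp7 hlt
      exact conclude a 8 hpos hneg ha hp
    · obtain ⟨a, hpos, hneg, ha, hp⟩ := exists_weights hu.ne_zero (by decide) hp8 hlt
      exact conclude a 7 hpos hneg ha (by rwa [add_comm])
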